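/- **Proposition 6.1.** A convex body is a compact convex set with non-empty interior. For $t\in\mathbb{R}$ let $T_t:\mathbb{R}^3\to\mathbb{R}^2$ be the linear projection onto $\mathbb{R}^2$ parallel to $e_3+te_2$, i.e. $T_t(x,y,r)=(x,y-tr)$. Let $\{K(t)\}_{t\in\mathbb{R}}$ be a shadow system of convex bodies in $\mathbb{R}^2$ in the direction of $e_2$: every $K(t)$ is a convex body, and there is a compact convex set $\tilde K\subset\mathbb{R}^3$ with $K(t)=T_t(\tilde K)$ for all $t\in\mathbb{R}$. For a convex body $K\subset\mathbb{R}^2$ put $$L(K)=(K-K)^\circ=\{x\in\mathbb{R}^2 : \langle x,y-y'\rangle\le 1 \text{ for all } y,y'\in K\}.$$ Let $S,T\subset\mathbb{R}$ be non-empty open intervals, and let $a:S\to\mathbb{R}$ be a function and $\Psi:S\to\mathbb{R}$ a continuous function such that $$(a(s)+\Psi(s)t,\;s)\in\partial L(K(t))\qquad\text{for all } s\in S \text{ and } t\in T.$$ Then there exist $c_+,c_-\in\mathbb{R}$ such that $$\Psi(s)=c_+s_+-c_-s_-\qquad\text{for all } s\in S,$$ where $s_+=\max(s,0)$ and $s_-=\max(-s,0)$.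 -/

import Mathlib

open scoped Pointwise

/-- A convex body: a compact convex set with non-empty interior. -/
structure IsConvexBody {n : ℕ} (K : Set (EuclideanSpace ℝ (Fin n))) : Prop where
  isCompact : IsCompact K
  convex : Convex ℝ K
  interior_nonempty : (interior K).Nonempty

/-- The linear projection `T_t` of `ℝⁿ⁺¹ = ℝⁿ × ℝ` onto `ℝⁿ` parallel to `e_{n+1} + t u`:
it fixes `ℝⁿ` pointwise and kills `(t u, 1)`, so it sends `(y, r)` to `y - r t u`. -/
noncomputable def shadowProj {n : ℕ} (u : EuclideanSpace ℝ (Fin n)) (t : ℝ)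
    (z : EuclideanSpace ℝ (Fin (n + 1))) : EuclideanSpace ℝ (Fin n) :=
  WithLp.toLp 2 (fun i : Fin n => z i.castSucc - z (Fin.last n) * t * u i)

/-- `{K(t)}_{t ∈ ℝ}` is a shadow system of convex bodies in the direction of the unit vector `u`:
`K(t) = T_t(K')` for all `t`, for a single compact convex set `K'` in `ℝⁿ⁺¹`. -/
structure IsShadowSystem {n : ℕ} (u : EuclideanSpace ℝ (Fin n))
    (K : ℝ → Set (EuclideanSpace ℝ (Fin n))) : Prop where
  norm_dir : ‖u‖ = 1
  isConvexBody : ∀ t : ℝ, IsConvexBody (K t)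
  exists_lift : ∃ K' : Set (EuclideanSpace ℝ (Fin (n + 1))),
    IsCompact K' ∧ Convex ℝ K' ∧ ∀ t : ℝ, K t = shadowProj u t '' K'

/-- The polar `K° = {x ; ⟨x, y⟩ ≤ 1 for all y ∈ K}`. -/
def polarBody {n : ℕ} (K : Set (EuclideanSpace ℝ (Fin n))) : Set (EuclideanSpace ℝ (Fin n)) :=
  {x | ∀ y ∈ K, inner ℝ x y ≤ 1}

/-- `L(K) = (K - K)°`, where `K - K` is the Minkowski difference `{x - y ; x, y ∈ K}`. -/
def polarDiffBody {n : ℕ} (K : Set (EuclideanSpace ℝ (Fin n))) :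
    Set (EuclideanSpace ℝ (Fin n)) :=
  polarBody (K - K)

open Set

/-! Let g(x, t) be the support function of C - C at (x, 1, -t), where C is the lift; g is jointly
convex. For s > 0, homogeneity turns the boundary condition into g = 1/s along a segment in (x, t)
of slope Ψ(s)/s, so these slopes must be shown not to depend on the level l = 1/s. Take segments at
levels l and l' and average a point over t₀ + u with one over t₀ - u. The midpoint lies over t₀ at
level at most (l + l')/2, so the difference of slopes is bounded by the midpoint defect of the
concave function sending a level to the right end of its sublevel set
(`exists_monotone_slope_bound`). That defect is at most l' - l times the increment of a monotone
function; summing over fine partitions forces equal slopes. Evenness of the support function handles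
s < 0, and continuity handles s = 0. -/

/-! ### Convex functions of one variable -/

/-- A function whose increments over `[x, y]` are bounded by `(y - x) (G y - G x)` with `G`
monotone takes the same value at the endpoints. -/
theorem eq_of_abs_sub_le_mul_monotone {φ G : ℝ → ℝ} {p q : ℝ} (hpq : p < q)
    (h : ∀ x ∈ Icc p q, ∀ y ∈ Icc p q, x < y → |φ x - φ y| ≤ (y - x) * (G y - G x)) :
    φ p = φ q := by
  have key : ∀ n : ℕ, |φ p - φ q| * ((n : ℝ) + 1) ≤ (q - p) * (G q - G p) := by
    intro n
    have hn : (0 : ℝ) < (n : ℝ) + 1 := by positivity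
    -- On a uniform mesh of n + 1 steps the increments of `G` telescope, leaving a total of order
    -- 1/(n + 1).
    set d := (q - p) / ((n : ℝ) + 1) with hd
    have hd0 : 0 < d := div_pos (sub_pos.2 hpq) hn
    have hdn : d * ((n : ℝ) + 1) = q - p := by rw [hd]; field_simp
    have step : ∀ k : ℕ, k ≤ n + 1 → |φ p - φ (p + k * d)| ≤ d * (G (p + k * d) - G p) := by
      intro k
      induction k with
      | zero => intro _; simp
      | succ k ih =>
        intro hk
        have hk' : (k : ℝ) + 1 ≤ (n : ℝ) + 1 := by exact_mod_cast hk
        have h1 := ih (by omega)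
        have hk0 : (0 : ℝ) ≤ k := Nat.cast_nonneg k
        have hm : p + k * d ∈ Icc p q := ⟨by nlinarith, by nlinarith⟩
        have hm' : p + (k + 1 : ℝ) * d ∈ Icc p q := ⟨by nlinarith, by nlinarith⟩
        have h2 := h _ hm _ hm' (by nlinarith)
        have h3 := abs_sub_le (φ p) (φ (p + k * d)) (φ (p + (k + 1 : ℝ) * d))
        push_cast
        have h4 : p + (k + 1 : ℝ) * d - (p + k * d) = d := by ring
        rw [h4] at h2
        nlinarith
    have h1 := step (n + 1) le_rfl
    have h2 : p + ((n + 1 : ℕ) : ℝ) * d = q := by push_cast; linarith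
    rw [h2] at h1
    calc |φ p - φ q| * ((n : ℝ) + 1) ≤ d * (G q - G p) * ((n : ℝ) + 1) := by gcongr
      _ = (q - p) * (G q - G p) := by rw [← hdn]; ring
  by_contra hne
  have hpos : 0 < |φ p - φ q| := abs_pos.2 (sub_ne_zero.2 hne)
  obtain ⟨n, hn⟩ := exists_nat_gt ((q - p) * (G q - G p) / |φ p - φ q|)
  rw [div_lt_iff₀ hpos] at hn
  have := key n
  nlinarith

/-- The midpoint defect of a convex function is controlled by the increment of its right
derivative. -/
theorem ConvexOn.add_sub_two_mul_midpoint_le {f : ℝ → ℝ} {c x y : ℝ}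
    (hf : ConvexOn ℝ (Ioi c) f) (hx : c < x) (hxy : x < y) :
    f x + f y - 2 * f ((x + y) / 2) ≤
      (y - x) * (derivWithin f (Ioi y) y - derivWithin f (Ioi x) x) / 2 := by
  have hxi : x ∈ interior (Ioi c) := by rw [interior_Ioi]; exact hx
  have hyi : y ∈ interior (Ioi c) := by rw [interior_Ioi]; exact hx.trans hxy
  have hm : (x + y) / 2 ∈ Ioi c := by simp only [mem_Ioi]; linarith
  have hxm : x < (x + y) / 2 := by linarith
  have hmy : (x + y) / 2 < y := by linarith
  have h1 := hf.rightDeriv_le_slope_of_mem_interior hxi hm hxm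
  have h2 := (hf.slope_le_leftDeriv_of_mem_interior hm hyi hmy).trans
    (hf.leftDeriv_le_rightDeriv_of_mem_interior hyi)
  rw [slope_def_field, le_div_iff₀ (by linarith)] at h1
  rw [slope_def_field, div_le_iff₀ (by linarith)] at h2
  linarith

/-- Averages of near-maximal points of two sublevel sets lie in the sublevel set of the averaged
level. -/
theorem ConvexOn.concaveOn_sSup_sublevel {h : ℝ → ℝ} (hh : ConvexOn ℝ univ h) {z : ℝ}
    (hb : ∀ c, BddAbove {x | h x ≤ c}) :
    ConcaveOn ℝ (Ioi (h z)) fun c => sSup {x | h x ≤ c} := by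
  refine ⟨convex_Ioi _, ?_⟩
  intro c hc d hd a b ha hb' hab
  simp only [smul_eq_mul]
  have hne : ∀ e ∈ Ioi (h z), {x | h x ≤ e}.Nonempty := fun e he => ⟨z, (mem_Ioi.1 he).le⟩
  refine le_of_forall_pos_le_add fun ε hε => ?_
  obtain ⟨x, hx, hxc⟩ := exists_lt_of_lt_csSup (hne c hc) (sub_lt_self (sSup {x | h x ≤ c}) hε)
  obtain ⟨y, hy, hyd⟩ := exists_lt_of_lt_csSup (hne d hd) (sub_lt_self (sSup {x | h x ≤ d}) hε)
  have hmem : a * x + b * y ∈ {x | h x ≤ a * c + b * d} := by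
    have := hh.2 (mem_univ x) (mem_univ y) ha hb' hab
    simp only [smul_eq_mul] at this
    simp only [mem_ofPred_eq] at hx hy ⊢
    nlinarith [mul_le_mul_of_nonneg_left hx ha, mul_le_mul_of_nonneg_left hy hb']
  have := le_csSup (hb _) hmem
  have h1 := mul_le_mul_of_nonneg_left hxc.le ha
  have h2 := mul_le_mul_of_nonneg_left hyd.le hb'
  have h3 : a * ε + b * ε = ε := by rw [← add_mul, hab, one_mul]
  linarith

/-- Beyond `x` the slopes are at least the positive slope from `z` to `x`, so `h` grows at least
linearly. -/
theorem ConvexOn.bddAbove_sublevel {h : ℝ → ℝ} (hh : ConvexOn ℝ univ h) {z x : ℝ} (hzx : z < x)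
    (hlt : h z < h x) (c : ℝ) : BddAbove {y | h y ≤ c} := by
  have hd : 0 < (h x - h z) / (x - z) := div_pos (sub_pos.2 hlt) (sub_pos.2 hzx)
  refine ⟨max x (x + (c - h x) / ((h x - h z) / (x - z))), fun y hy => ?_⟩
  rcases le_or_gt y x with hyx | hxy
  · exact le_max_of_le_left hyx
  · apply le_max_of_le_right
    have h1 := hh.slope_mono_adjacent (mem_univ z) (mem_univ y) hzx hxy
    rw [le_div_iff₀ (sub_pos.2 hxy)] at h1
    have h2 : y - x ≤ (c - h x) / ((h x - h z) / (x - z)) := by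
      rw [le_div_iff₀ hd]
      have : h y ≤ c := hy
      linarith
    linarith

/-! ### Slopes of segments in level sets -/

/-- If the level sets of a jointly convex function `g` contain segments over `[t₀ - δ, t₀ + δ]`,
then the slopes of those segments lying to the right of a point `z` of lower level obey a
second-order bound. -/
theorem exists_monotone_slope_bound {g : ℝ × ℝ → ℝ} (hg : ConvexOn ℝ univ g)
    {β φ : ℝ → ℝ} {t₀ δ p q z : ℝ} (hδ : 0 < δ) (hz : g (z, t₀) < p)
    (hlev : ∀ l ∈ Icc p q, ∀ u, |u| ≤ δ → g (β l + φ l * u, t₀ + u) = l) :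
    ∃ G : ℝ → ℝ, MonotoneOn G (Icc p q) ∧ ∀ x ∈ Icc p q, ∀ y ∈ Icc p q, z < β x → z < β y →
      x < y → |φ x - φ y| ≤ (y - x) * (G y - G x) := by
  by_cases hR : ∃ l ∈ Icc p q, z < β l
  swap
  · exact ⟨fun _ => 0, fun _ _ _ _ _ => le_rfl, fun x hx _ _ hzx => (hR ⟨x, hx, hzx⟩).elim⟩
  obtain ⟨l₁, hl₁, hzl₁⟩ := hR
  set h : ℝ → ℝ := fun x => g (x, t₀) with hh
  have hconv : ConvexOn ℝ univ h := by
    refine ⟨convex_univ, fun x _ y _ a b ha hb hab => ?_⟩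
    have := hg.2 (mem_univ (x, t₀)) (mem_univ (y, t₀)) ha hb hab
    have he : a • (x, t₀) + b • (y, t₀) = (a • x + b • y, t₀) := by
      ext
      · simp
      · simp [← add_mul, hab]
    rwa [he] at this
  have hβ : ∀ l ∈ Icc p q, h (β l) = l := fun l hl => by
    simpa using hlev l hl 0 (by simpa using hδ.le)
  have hbdd : ∀ c, BddAbove {x | h x ≤ c} :=
    hconv.bddAbove_sublevel hzl₁ (by rw [hβ l₁ hl₁]; exact hz.trans_le hl₁.1)
  set F : ℝ → ℝ := fun c => sSup {x | h x ≤ c} with hF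
  have hFconv : ConvexOn ℝ (Ioi (h z)) (-F) := (hconv.concaveOn_sSup_sublevel hbdd).neg
  -- Having risen from `z` to `β l`, the convex `h` exceeds `l` everywhere beyond `β l`.
  have hFβ : ∀ l ∈ Icc p q, z < β l → F l = β l := by
    intro l hl hzl
    refine IsGreatest.csSup_eq ⟨(hβ l hl).le, fun y hy => ?_⟩
    by_contra! hlt
    have h1 := hconv.slope_mono_adjacent (mem_univ z) (mem_univ y) hzl hlt
    rw [hβ l hl] at h1
    have h2 : 0 < (l - h z) / (β l - z) :=
      div_pos (sub_pos.2 (hz.trans_le hl.1)) (sub_pos.2 hzl)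
    have h3 : (h y - l) / (y - β l) ≤ 0 :=
      div_nonpos_of_nonpos_of_nonneg (sub_nonpos.2 hy) (sub_pos.2 hlt).le
    linarith
  refine ⟨fun x => derivWithin (-F) (Ioi x) x / (2 * δ), ?_, ?_⟩
  · intro x hx y hy hxy
    have := hFconv.monotoneOn_rightDeriv (a := x) (b := y)
      (by rw [interior_Ioi]; exact hz.trans_le hx.1) (by rw [interior_Ioi]; exact hz.trans_le hy.1)
      hxy
    simp only at this ⊢
    gcongr
  · intro x hx y hy hzx hzy hxy
    -- The two segments are traversed in opposite time directions, so the midpoint stays over `t₀`;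
    -- `u = ±δ` then bounds the absolute value of the slope difference.
    have hmid : ∀ u, |u| ≤ δ → (β x + φ x * u + (β y - φ y * u)) / 2 ≤ F ((x + y) / 2) := by
      intro u hu
      refine le_csSup (hbdd _) ?_
      have h1 := hlev x hx u hu
      have h2 := hlev y hy (-u) (by rwa [abs_neg])
      have h3 := hg.2 (mem_univ (β x + φ x * u, t₀ + u)) (mem_univ (β y + φ y * -u, t₀ + -u))
        (by norm_num : (0 : ℝ) ≤ 1 / 2) (by norm_num : (0 : ℝ) ≤ 1 / 2) (by norm_num)
      rw [h1, h2] at h3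
      have he : (1 / 2 : ℝ) • (β x + φ x * u, t₀ + u) + (1 / 2 : ℝ) • (β y + φ y * -u, t₀ + -u)
          = ((β x + φ x * u + (β y - φ y * u)) / 2, t₀) := by
        ext <;> simp <;> ring
      rw [he] at h3
      simp only [smul_eq_mul] at h3
      simp only [hh, mem_ofPred_eq]
      linarith
    have hdef := hFconv.add_sub_two_mul_midpoint_le (hz.trans_le hx.1) hxy
    simp only [Pi.neg_apply, hFβ x hx hzx, hFβ y hy hzy] at hdef
    have h1 := hmid δ (abs_of_pos hδ).le
    have h2 := hmid (-δ) (by rw [abs_neg, abs_of_pos hδ])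
    have h3 : |φ x - φ y| * δ ≤
        (y - x) * (derivWithin (-F) (Ioi y) y - derivWithin (-F) (Ioi x) x) / 2 := by
      rcases abs_cases (φ x - φ y) with ⟨h, _⟩ | ⟨h, _⟩ <;> rw [h] <;> nlinarith
    rw [← le_div_iff₀ hδ] at h3
    refine h3.trans (le_of_eq ?_)
    field_simp

/-- If the level sets of a jointly convex function `g` contain segments over `[t₀ - δ, t₀ + δ]`
whose slopes depend continuously on the level, then the slopes are constant. -/
theorem slope_eq_of_level_segments {g : ℝ × ℝ → ℝ} (hg : ConvexOn ℝ univ g)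
    {β φ : ℝ → ℝ} {t₀ δ p q z : ℝ} (hδ : 0 < δ) (hpq : p < q) (hz : g (z, t₀) < p)
    (hφ : ContinuousOn φ (Icc p q))
    (hlev : ∀ l ∈ Icc p q, ∀ u, |u| ≤ δ → g (β l + φ l * u, t₀ + u) = l) :
    φ p = φ q := by
  obtain ⟨G₁, hG₁, hb₁⟩ := exists_monotone_slope_bound hg hδ hz hlev
  -- Reflection in the first coordinate brings base points left of `z` to its right.
  have hg' : ConvexOn ℝ univ fun w : ℝ × ℝ => g (-w.1, w.2) := by
    refine ⟨convex_univ, fun x _ y _ a b ha hb hab => ?_⟩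
    have := hg.2 (mem_univ (-x.1, x.2)) (mem_univ (-y.1, y.2)) ha hb hab
    convert this using 2
    ext <;> simp
    ring
  obtain ⟨G₂, hG₂, hb₂⟩ := exists_monotone_slope_bound (β := fun l => -β l) (φ := fun l => -φ l)
    (z := -z) hg' hδ (by simpa using hz) (fun l hl u hu => by
      have := hlev l hl u hu
      simpa [neg_add, add_comm] using this)
  set G : ℝ → ℝ := fun x => G₁ x + G₂ x with hG
  have hGmono : MonotoneOn G (Icc p q) := hG₁.add hG₂
  have hne : ∀ l ∈ Icc p q, z < β l ∨ β l < z := by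
    intro l hl
    have h1 : g (β l, t₀) = l := by simpa using hlev l hl 0 (by simpa using hδ.le)
    rcases lt_trichotomy z (β l) with h | h | h
    · exact Or.inl h
    · rw [← h] at h1
      exact absurd hz (not_lt.2 (h1 ▸ hl.1))
    · exact Or.inr h
  have hsame : ∀ x ∈ Icc p q, ∀ y ∈ Icc p q, (z < β x ∧ z < β y ∨ β x < z ∧ β y < z) → x ≤ y →
      |φ x - φ y| ≤ (y - x) * (G y - G x) := by
    intro x hx y hy hs hxy
    rcases hxy.eq_or_lt with rfl | hxy
    · simp
    have m1 := mul_nonneg (sub_pos.2 hxy).le (sub_nonneg.2 (hG₁ hx hy hxy.le))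
    have m2 := mul_nonneg (sub_pos.2 hxy).le (sub_nonneg.2 (hG₂ hx hy hxy.le))
    simp only [hG]
    rcases hs with ⟨h1, h2⟩ | ⟨h1, h2⟩
    · have := hb₁ x hx y hy h1 h2 hxy
      nlinarith
    · have := hb₂ x hx y hy (neg_lt_neg h1) (neg_lt_neg h2) hxy
      rw [neg_sub_neg, abs_sub_comm] at this
      nlinarith
  -- The factor 2 pays for two same-side estimates when `β x` and `β y` lie on opposite sides of
  -- `z`.
  refine eq_of_abs_sub_le_mul_monotone (G := fun x => 2 * G x) hpq fun x hx y hy hxy => ?_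
  have hsub : Icc x y ⊆ Icc p q := Icc_subset_Icc hx.1 hy.2
  have hnn : 0 ≤ (y - x) * (G y - G x) :=
    mul_nonneg (sub_pos.2 hxy).le (sub_nonneg.2 (hGmono hx hy hxy.le))
  have hmono : ∀ r ∈ Icc x y, ∀ s ∈ Icc x y, r ≤ s →
      (s - r) * (G s - G r) ≤ (y - x) * (G y - G x) := by
    intro r hr s hs hrs
    have h1 := hGmono hx (hsub hr) hr.1
    have h2 := hGmono (hsub hs) hy hs.2
    have h3 := hGmono (hsub hr) (hsub hs) hrs
    exact mul_le_mul (by linarith [hr.1, hs.2]) (by linarith) (by linarith) (by linarith)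
  by_cases hs : z < β x ∧ z < β y ∨ β x < z ∧ β y < z
  · have := hsame x hx y hy hs hxy.le
    linarith
  refine le_of_forall_pos_le_add fun ε hε => ?_
  -- `β` may jump across `z`, as it is not assumed continuous. By connectedness some level is a
  -- limit both of levels on the side of `x` and of levels on the side of `y`; continuity of `φ`
  -- there makes the crossing cost less than `ε`.
  set A := {l | l ∈ Icc x y ∧ (z < β x ∧ z < β l ∨ β x < z ∧ β l < z)} with hA
  set B := {l | l ∈ Icc x y ∧ (z < β l ∧ z < β y ∨ β l < z ∧ β y < z)} with hB
  have hxA : x ∈ A := ⟨left_mem_Icc.2 hxy.le, by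
    rcases hne x hx with h | h
    · exact Or.inl ⟨h, h⟩
    · exact Or.inr ⟨h, h⟩⟩
  have hyB : y ∈ B := ⟨right_mem_Icc.2 hxy.le, by
    rcases hne y hy with h | h
    · exact Or.inl ⟨h, h⟩
    · exact Or.inr ⟨h, h⟩⟩
  have hcover : Icc x y ⊆ closure A ∪ closure B := by
    intro l hl
    have h1 := hne x hx
    have h2 := hne y hy
    have h3 := hne l (hsub hl)
    have : l ∈ A ∨ l ∈ B := by
      simp only [hA, hB, mem_ofPred_eq]
      tauto
    exact this.imp (fun h => subset_closure h) (fun h => subset_closure h)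
  obtain ⟨c, hc, hcA, hcB⟩ := isPreconnected_closed_iff.1 (isPreconnected_Icc (a := x) (b := y))
    (closure A) (closure B) isClosed_closure isClosed_closure hcover
    ⟨x, left_mem_Icc.2 hxy.le, subset_closure hxA⟩ ⟨y, right_mem_Icc.2 hxy.le, subset_closure hyB⟩
  obtain ⟨η, hη, hcont⟩ := Metric.continuousOn_iff.1 hφ c (hsub hc) (ε / 2) (half_pos hε)
  obtain ⟨r, hr, hrc⟩ := Metric.mem_closure_iff.1 hcA η hη
  obtain ⟨s, hs', hsc⟩ := Metric.mem_closure_iff.1 hcB η hη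
  have e1 := hcont r (hsub hr.1) (by rwa [dist_comm])
  have e2 := hcont s (hsub hs'.1) (by rwa [dist_comm])
  have e3 : |φ r - φ s| < ε := by
    have := dist_triangle_right (φ r) (φ s) (φ c)
    rw [Real.dist_eq] at this
    linarith
  have b1 := (hsame x hx r (hsub hr.1) hr.2 hr.1.1).trans
    (hmono x (left_mem_Icc.2 hxy.le) r hr.1 hr.1.1)
  have b2 := (hsame s (hsub hs'.1) y hy hs'.2 hs'.1.2).trans
    (hmono s hs'.1 y (right_mem_Icc.2 hxy.le) hs'.1.2)
  have t1 := abs_sub_le (φ x) (φ r) (φ y)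
  have t2 := abs_sub_le (φ r) (φ s) (φ y)
  linarith

/-! ### Polars and the width function -/

/-- A boundary point of the polar of a bounded set `D` has support value `1`. -/
theorem isLUB_inner_of_mem_frontier_polarBody {n : ℕ} {D : Set (EuclideanSpace ℝ (Fin n))}
    (hD : Bornology.IsBounded D) {v : EuclideanSpace ℝ (Fin n)}
    (hv : v ∈ frontier (polarBody D)) : IsLUB ((fun y => inner ℝ v y) '' D) 1 := by
  have hcl : IsClosed (polarBody D) := by
    have : polarBody D = ⋂ y ∈ D, {x | inner ℝ x y ≤ 1} := by
      ext x
      simp [polarBody]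
    rw [this]
    exact isClosed_biInter fun y _ => isClosed_le (by fun_prop) continuous_const
  have hmem : v ∈ polarBody D := hcl.frontier_subset hv
  refine ⟨?_, fun c hc => ?_⟩
  · rintro _ ⟨y, hy, rfl⟩
    exact hmem y hy
  · by_contra! hlt
    obtain ⟨M, hM0, hM⟩ := hD.exists_pos_norm_le
    -- With `D` in the ball of radius `M`, moving `v` by less than (1 - c)/M keeps all inner
    -- products at most 1.
    refine hv.2 (mem_interior_iff_mem_nhds.2 (Metric.mem_nhds_iff.2
      ⟨(1 - c) / M, div_pos (sub_pos.2 hlt) hM0, fun w hw y hy => ?_⟩))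
    rw [Metric.mem_ball, dist_eq_norm, lt_div_iff₀ hM0] at hw
    have h1 : inner ℝ v y ≤ c := hc ⟨y, hy, rfl⟩
    have h2 : inner ℝ (w - v) y ≤ ‖w - v‖ * ‖y‖ := real_inner_le_norm _ _
    have h3 : ‖w - v‖ * ‖y‖ ≤ ‖w - v‖ * M := by gcongr; exact hM y hy
    rw [inner_sub_left] at h2
    linarith

/-- The support function of the difference body of a set in `ℝ³`. -/
noncomputable def widthFun (C : Set (EuclideanSpace ℝ (Fin 3))) (x y r : ℝ) : ℝ :=
  sSup ((fun w : EuclideanSpace ℝ (Fin 3) × EuclideanSpace ℝ (Fin 3) =>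
    x * (w.1 0 - w.2 0) + y * (w.1 1 - w.2 1) + r * (w.1 2 - w.2 2)) '' (C ×ˢ C))

theorem bddAbove_widthFun {C : Set (EuclideanSpace ℝ (Fin 3))} (hC : IsCompact C) (x y r : ℝ) :
    BddAbove ((fun w : EuclideanSpace ℝ (Fin 3) × EuclideanSpace ℝ (Fin 3) =>
      x * (w.1 0 - w.2 0) + y * (w.1 1 - w.2 1) + r * (w.1 2 - w.2 2)) '' (C ×ˢ C)) :=
  (hC.prod hC).bddAbove_image (by fun_prop)

theorem convexOn_widthFun {C : Set (EuclideanSpace ℝ (Fin 3))} (hC : IsCompact C)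
    (hne : C.Nonempty) :
    ConvexOn ℝ univ fun w : ℝ × ℝ => widthFun C w.1 1 (-w.2) := by
  refine ⟨convex_univ, fun v _ w _ a b ha hb hab => ?_⟩
  refine csSup_le ((hne.prod hne).image _) ?_
  rintro _ ⟨k, hk, rfl⟩
  have h1 : _ ≤ widthFun C v.1 1 (-v.2) := le_csSup (bddAbove_widthFun hC _ _ _) ⟨k, hk, rfl⟩
  have h2 : _ ≤ widthFun C w.1 1 (-w.2) := le_csSup (bddAbove_widthFun hC _ _ _) ⟨k, hk, rfl⟩
  have h3 := mul_le_mul_of_nonneg_left h1 ha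
  have h4 := mul_le_mul_of_nonneg_left h2 hb
  obtain rfl : b = 1 - a := by linarith
  simp only [smul_eq_mul, Prod.fst_add, Prod.snd_add, Prod.smul_fst, Prod.smul_snd]
  refine le_trans (le_of_eq ?_) (add_le_add h3 h4)
  ring

theorem widthFun_neg (C : Set (EuclideanSpace ℝ (Fin 3))) (x y r : ℝ) :
    widthFun C (-x) (-y) (-r) = widthFun C x y r := by
  unfold widthFun
  congr 1
  ext e
  constructor
  all_goals
    rintro ⟨⟨k, k'⟩, ⟨hk, hk'⟩, rfl⟩
    exact ⟨(k', k), ⟨hk', hk⟩, by simp only; ring⟩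

theorem widthFun_smul (C : Set (EuclideanSpace ℝ (Fin 3))) {c : ℝ} (hc : 0 ≤ c) (x y r : ℝ) :
    widthFun C (c * x) (c * y) (c * r) = c * widthFun C x y r := by
  unfold widthFun
  rw [← smul_eq_mul c (sSup _), ← Real.sSup_smul_of_nonneg hc, ← image_smul, image_image]
  congr 2
  ext w
  simp only [smul_eq_mul]
  ring

/-- The adjoint of the projection sends (x, s) to (x, s, -st), so the support function of the
projected difference body is a value of `widthFun`. -/
theorem widthFun_eq_one_of_mem_frontier {C : Set (EuclideanSpace ℝ (Fin 3))} (hC : IsCompact C)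
    (hne : C.Nonempty) {x s t : ℝ}
    (h : !₂[x, s] ∈ frontier (polarDiffBody
      (shadowProj (EuclideanSpace.single (1 : Fin 2) (1 : ℝ)) t '' C))) :
    widthFun C x s (-(s * t)) = 1 := by
  have hcont : Continuous (shadowProj (EuclideanSpace.single (1 : Fin 2) (1 : ℝ)) t) := by
    unfold shadowProj
    fun_prop
  have hcomp := hC.image hcont
  have hlub := isLUB_inner_of_mem_frontier_polarBody (hcomp.isBounded.sub hcomp.isBounded) h
  rw [← hlub.csSup_eq (((hne.image _).sub (hne.image _)).image _)]
  unfold widthFun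
  congr 1
  have hval : ∀ k k' : EuclideanSpace ℝ (Fin 3),
      inner ℝ !₂[x, s] (shadowProj (EuclideanSpace.single (1 : Fin 2) (1 : ℝ)) t k -
        shadowProj (EuclideanSpace.single (1 : Fin 2) (1 : ℝ)) t k') =
      x * (k 0 - k' 0) + s * (k 1 - k' 1) + -(s * t) * (k 2 - k' 2) := by
    intro k k'
    have e1 : Fin.castSucc (1 : Fin 2) = (1 : Fin 3) := rfl
    simp [shadowProj, PiLp.inner_apply, Fin.sum_univ_two, e1]
    ring
  ext e
  constructor
  · rintro ⟨⟨k, k'⟩, ⟨hk, hk'⟩, rfl⟩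
    exact ⟨_, sub_mem_sub (mem_image_of_mem _ hk) (mem_image_of_mem _ hk'), hval k k'⟩
  · rintro ⟨_, ⟨_, ⟨k, hk, rfl⟩, _, ⟨k', hk', rfl⟩, rfl⟩, rfl⟩
    exact ⟨(k, k'), ⟨hk, hk'⟩, (hval k k').symm⟩

/-! ### Constancy of Ψ(s)/s and conclusion -/

theorem div_eq_div_of_widthFun_eq_one {C : Set (EuclideanSpace ℝ (Fin 3))} (hC : IsCompact C)
    (hne : C.Nonempty) {S T : Set ℝ} (hS_open : IsOpen S) (hS_interval : S.OrdConnected)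
    (hT_open : IsOpen T) (hT_nonempty : T.Nonempty) {a Ψ : ℝ → ℝ} (hΨ : ContinuousOn Ψ S)
    (h : ∀ s ∈ S, ∀ t ∈ T, widthFun C (a s + Ψ s * t) s (-(s * t)) = 1)
    {s₁ s₂ : ℝ} (h₁ : s₁ ∈ S) (h₂ : s₂ ∈ S) (hs₁ : 0 < s₁) (hs₂ : 0 < s₂) :
    Ψ s₁ / s₁ = Ψ s₂ / s₂ := by
  wlog hlt : s₁ < s₂ generalizing s₁ s₂
  · rcases (not_lt.1 hlt).eq_or_lt with rfl | hlt
    · rfl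
    · exact (this h₂ h₁ hs₂ hs₁ hlt).symm
  obtain ⟨ε, hε, hball⟩ := Metric.isOpen_iff.1 hS_open s₂ h₂
  -- A parameter beyond `s₂` supplies the point `z` of level 1/s₃, strictly below all levels in
  -- [1/s₂, 1/s₁].
  set s₃ := s₂ + ε / 2 with hs₃
  have h₃ : s₃ ∈ S := hball (by
    rw [Metric.mem_ball, Real.dist_eq, hs₃, add_sub_cancel_left, abs_of_pos (half_pos hε)]
    exact half_lt_self hε)
  have h23 : s₂ < s₃ := by linarith
  obtain ⟨t₀, ht₀⟩ := hT_nonempty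
  obtain ⟨η, hη, hTball⟩ := Metric.isOpen_iff.1 hT_open t₀ ht₀
  have hlevel : ∀ s ∈ S, 0 < s → ∀ u, |u| ≤ η / 2 →
      widthFun C ((a s + Ψ s * t₀) / s + Ψ s / s * u) 1 (-(t₀ + u)) = s⁻¹ := by
    intro s hs hs0 u hu
    have ht : t₀ + u ∈ T := hTball (by
      rw [Metric.mem_ball, Real.dist_eq, add_sub_cancel_left]; linarith)
    have h1 := h s hs _ ht
    have h2 := widthFun_smul C (inv_pos.2 hs0).le (a s + Ψ s * (t₀ + u)) s (-(s * (t₀ + u)))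
    rw [h1, mul_one] at h2
    rw [← h2]
    congr 1 <;> field_simp
    ring
  have hinv : ∀ l ∈ Icc s₂⁻¹ s₁⁻¹, l⁻¹ ∈ S ∧ 0 < l := by
    intro l hl
    have hl0 : 0 < l := (inv_pos.2 hs₂).trans_le hl.1
    exact ⟨hS_interval.out h₁ h₂ ⟨(le_inv_comm₀ hs₁ hl0).2 hl.2, (inv_le_comm₀ hl0 hs₂).2 hl.1⟩, hl0⟩
  have key := slope_eq_of_level_segments (convexOn_widthFun hC hne)
    (β := fun l => (a l⁻¹ + Ψ l⁻¹ * t₀) / l⁻¹) (φ := fun l => Ψ l⁻¹ / l⁻¹)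
    (t₀ := t₀) (δ := η / 2) (p := s₂⁻¹) (q := s₁⁻¹) (z := (a s₃ + Ψ s₃ * t₀) / s₃)
    (half_pos hη) ((inv_lt_inv₀ hs₂ hs₁).2 hlt) ?_ ?_ ?_
  · simpa using key.symm
  · have := hlevel s₃ h₃ (hs₂.trans h23) 0 (by simpa using (half_pos hη).le)
    simp only [mul_zero, add_zero] at this
    rw [this]
    exact (inv_lt_inv₀ (hs₂.trans h23) hs₂).2 h23
  · have hc : ContinuousOn (fun l : ℝ => l⁻¹) (Icc s₂⁻¹ s₁⁻¹) :=
      continuousOn_inv₀.mono fun l hl => (hinv l hl).2.ne'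
    exact (hΨ.comp hc fun l hl => (hinv l hl).1).div hc
      fun l hl => (inv_pos.2 (hinv l hl).2).ne'
  · intro l hl u hu
    have := hlevel l⁻¹ (hinv l hl).1 (inv_pos.2 (hinv l hl).2) u hu
    rwa [inv_inv] at this

theorem proposition6p1
    (K : ℝ → Set (EuclideanSpace ℝ (Fin 2)))
    (hK : IsShadowSystem (EuclideanSpace.single (1 : Fin 2) (1 : ℝ)) K)
    (S T : Set ℝ)
    (hS_open : IsOpen S) (hS_interval : S.OrdConnected) (hS_nonempty : S.Nonempty)
    (hT_open : IsOpen T) (hT_interval : T.OrdConnected) (hT_nonempty : T.Nonempty)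
    (a Ψ : ℝ → ℝ) (hΨ : ContinuousOn Ψ S)
    (h : ∀ s ∈ S, ∀ t ∈ T, !₂[a s + Ψ s * t, s] ∈ frontier (polarDiffBody (K t))) :
    ∃ c_pos c_neg : ℝ, ∀ s ∈ S, Ψ s = c_pos * max s 0 - c_neg * max (-s) 0 := by
  obtain ⟨C, hC, -, hKC⟩ := hK.exists_lift
  have hne : C.Nonempty := by
    have := (hK.isConvexBody 0).interior_nonempty.mono interior_subset
    rw [hKC] at this
    exact this.of_image
  have hw : ∀ s ∈ S, ∀ t ∈ T, widthFun C (a s + Ψ s * t) s (-(s * t)) = 1 := by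
    intro s hs t ht
    have := h s hs t ht
    rw [hKC] at this
    exact widthFun_eq_one_of_mem_frontier hC hne this
  have hpos : ∃ c, ∀ s ∈ S, 0 < s → Ψ s = c * s := by
    by_cases hex : ∃ s ∈ S, 0 < s
    · obtain ⟨s₀, hs₀, h0⟩ := hex
      refine ⟨Ψ s₀ / s₀, fun s hs hs0 => ?_⟩
      rw [div_eq_div_of_widthFun_eq_one hC hne hS_open hS_interval hT_open hT_nonempty hΨ hw
        hs₀ hs h0 hs0, div_mul_cancel₀ _ hs0.ne']
    · exact ⟨0, fun s hs hs0 => (hex ⟨s, hs, hs0⟩).elim⟩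
  have hneg : ∃ c, ∀ s ∈ S, s < 0 → Ψ s = c * s := by
    by_cases hex : ∃ s ∈ S, s < 0
    · obtain ⟨s₀, hs₀, h0⟩ := hex
      refine ⟨Ψ s₀ / s₀, fun s hs hs0 => ?_⟩
      -- Evenness of `widthFun` preserves the hypothesis when `s`, `a` and `Ψ` all change sign.
      have key := div_eq_div_of_widthFun_eq_one (S := Neg.neg ⁻¹' S) (a := fun s => -a (-s))
        (Ψ := fun s => -Ψ (-s)) hC hne
        (hS_open.preimage continuous_neg)
        ⟨fun x hx y hy w hw => hS_interval.out hy hx ⟨neg_le_neg hw.2, neg_le_neg hw.1⟩⟩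
        hT_open hT_nonempty
        (hΨ.comp continuous_neg.continuousOn fun s hs => hs).neg
        (fun s hs t ht => by
          have := hw (-s) hs t ht
          rw [← widthFun_neg] at this
          rw [← this]
          congr 1 <;> ring)
        (s₁ := -s₀) (s₂ := -s) (by simpa using hs₀) (by simpa using hs)
        (neg_pos.2 h0) (neg_pos.2 hs0)
      simp only [neg_neg, neg_div_neg_eq] at key
      rw [key, div_mul_cancel₀ _ hs0.ne]
    · exact ⟨0, fun s hs hs0 => (hex ⟨s, hs, hs0⟩).elim⟩
  obtain ⟨c, hc⟩ := hpos
  obtain ⟨d, hd⟩ := hneg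
  refine ⟨c, d, fun s hs => ?_⟩
  rcases lt_trichotomy s 0 with hs0 | rfl | hs0
  · rw [hd s hs hs0, max_eq_right hs0.le, max_eq_left (neg_pos.2 hs0).le]
    ring
  -- The right-hand limit of `c * s` forces Ψ(0) = 0.
  · have hcont : Filter.Tendsto Ψ (nhdsWithin 0 (Ioi 0)) (nhds (Ψ 0)) :=
      ((hΨ.continuousAt (hS_open.mem_nhds hs)).tendsto).mono_left nhdsWithin_le_nhds
    have hlin : Filter.Tendsto (fun s : ℝ => c * s) (nhdsWithin 0 (Ioi 0)) (nhds (c * 0)) :=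
      ((continuous_const.mul continuous_id).tendsto 0).mono_left nhdsWithin_le_nhds
    have heq : (fun s : ℝ => c * s) =ᶠ[nhdsWithin 0 (Ioi 0)] Ψ := by
      filter_upwards [self_mem_nhdsWithin, nhdsWithin_le_nhds (hS_open.mem_nhds hs)] with s h1 h2
      exact (hc s h2 h1).symm
    have := tendsto_nhds_unique hcont (hlin.congr' heq)
    simpa using this
  · rw [hc s hs hs0, max_eq_left hs0.le, max_eq_right (neg_neg_of_pos hs0).le]
    ring
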